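/- Let $X$ be a real normed space that is barrelled, and let $X^*$ be its topological dual, with duality product $\langle x,x^*\rangle=x^*(x)$. Let $T:X\rightrightarrows X^*$ be a maximal monotone operator, i.e. $\langle x_1-x_2,x_1^*-x_2^*\rangle\ge 0$ whenever $x_1^*\in Tx_1$ and $x_2^*\in Tx_2$, and the graph of $T$ is not properly contained in the graph of another monotone operator. Suppose that the domain $D(T)=\{x\in X\mid Tx\neq\emptyset\}$ has nonempty core (algebraic interior), i.e. there is $a\in X$ such that for every $v\in X$ there is $\delta>0$ with $a+tv\in D(T)$ for all $t\in[0,\delta]$. Then $T$ has the Cesari property (Q) at every point of $X$: for every $x\in X$ and every net $(x_i)_{i\in I}$ in $X$ (indexed by a nonempty directed set $I$; the $x_i$ need not lie in $D(T)$) that converges to $x$ in norm, $$\bigcap_{i\in I}\operatorname{cl}_{w^*}\Bigl(\operatorname{conv}\bigcup_{j\ge i}Tx_j\Bigr)\subset Tx,$$ where $\operatorname{cl}_{w^*}$ denotes closure in the weak-star topology $\sigma(X^*,X)$ and $\operatorname{conv}$ the convex hull. -/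

import Mathlib

open Filter Topology

universe u w

namespace MonotoneOperators

/-- The graph of a set-valued operator from `X` to its topological dual. The dual is
`WeakDual ℝ X`, i.e. the continuous linear functionals with the weak-star topology. -/
def graph {X : Type u} [NormedAddCommGroup X] [NormedSpace ℝ X]
    (T : X → Set (WeakDual ℝ X)) : Set (X × WeakDual ℝ X) :=
  {p | p.2 ∈ T p.1}

/-- The domain `D(T) = {x | T x ≠ ∅}`. -/
def domain {X : Type u} [NormedAddCommGroup X] [NormedSpace ℝ X]
    (T : X → Set (WeakDual ℝ X)) : Set X :=
  {x | (T x).Nonempty}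

/-- `T` is monotone: `⟨x₁ - x₂, x₁* - x₂*⟩ ≥ 0` for all pairs in its graph. -/
def IsMonotone {X : Type u} [NormedAddCommGroup X] [NormedSpace ℝ X]
    (T : X → Set (WeakDual ℝ X)) : Prop :=
  ∀ p ∈ graph T, ∀ q ∈ graph T, 0 ≤ (p.2 - q.2) (p.1 - q.1)

/-- `T` is maximal monotone: monotone, and its graph is not properly contained in the graph of
another monotone operator. -/
def IsMaximalMonotone {X : Type u} [NormedAddCommGroup X] [NormedSpace ℝ X]
    (T : X → Set (WeakDual ℝ X)) : Prop :=
  IsMonotone T ∧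
    ∀ S : X → Set (WeakDual ℝ X), IsMonotone S → graph T ⊆ graph S → graph S = graph T

/-- The core (algebraic interior) of a subset of a real vector space. -/
def core {X : Type u} [AddCommGroup X] [Module ℝ X] (A : Set X) : Set X :=
  {a | ∀ v : X, ∃ δ : ℝ, 0 < δ ∧ ∀ t ∈ Set.Icc (0 : ℝ) δ, a + t • v ∈ A}

/-- `T` has property (Q) at `x`: for every net `(x_i)` (indexed by a nonempty directed set, here in
the universe `w`) that converges to `x` in norm, the intersection over `i` of the weak-star closed
convex hulls of `⋃_{j ≥ i} T x_j` is contained in `T x`. -/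
def HasPropertyQAt {X : Type u} [NormedAddCommGroup X] [NormedSpace ℝ X]
    (T : X → Set (WeakDual ℝ X)) (x : X) : Prop :=
  ∀ (ι : Type w) [Preorder ι] [IsDirectedOrder ι] [Nonempty ι] (y : ι → X),
    Tendsto y atTop (𝓝 x) →
      (⋂ i : ι, closure (convexHull ℝ (⋃ j ∈ Set.Ici i, T (y j)))) ⊆ T x

/-- `T` has property (Q): it has property (Q) at each point of the whole space. -/
def HasPropertyQ {X : Type u} [NormedAddCommGroup X] [NormedSpace ℝ X]
    (T : X → Set (WeakDual ℝ X)) : Prop :=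
  ∀ x : X, HasPropertyQAt.{u, w} T x

end MonotoneOperators

namespace MonotoneOperators

variable {X : Type u} [NormedAddCommGroup X] [NormedSpace ℝ X] {T : X → Set (WeakDual ℝ X)}

/-! The crux is a bound on the graph that is affine in the functional: `|h v| ≤ C‖v‖(K(1 + ‖y‖) + h
(y - a))` for `h ∈ T y`, with `a` in the core. It comes from Banach–Steinhaus, applied to the
functionals divided by the bracket. With `v = x - y j` it makes the cost of replacing `y j` by `x`
in the monotonicity inequality small and affine in `h`. That inequality then says that `h` lies in a
weak-star closed half-space independent of `j`, so it survives closed convex hulls although the `T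
(y j)` may be unbounded. Shrinking the error leaves `f` monotonically related to the graph, and
maximality concludes. -/

/-- A weak-star continuous functional is bounded in norm. -/
theorem exists_forall_abs_apply_le (f : WeakDual ℝ X) :
    ∃ N : ℝ, 0 ≤ N ∧ ∀ v, |f v| ≤ N * ‖v‖ :=
  ⟨‖WeakDual.toStrongDual f‖, norm_nonneg _, fun v => (WeakDual.toStrongDual f).le_opNorm v⟩

/-- Evaluation of a monotone graph against a fixed point of the domain grows at most linearly. -/
theorem IsMonotone.exists_apply_sub_le (hT : IsMonotone T) {z : X} (hz : z ∈ domain T) :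
    ∃ K : ℝ, 0 ≤ K ∧ ∀ p ∈ graph T, p.2 (z - p.1) ≤ K * (1 + ‖p.1‖) := by
  obtain ⟨f, hf⟩ := hz
  obtain ⟨N, hN, hfN⟩ := exists_forall_abs_apply_le f
  refine ⟨N * (1 + ‖z‖), by positivity, fun p hp => ?_⟩
  have hmon : 0 ≤ (f - p.2) (z - p.1) := hT (z, f) hf p hp
  have hsub : (f - p.2) (z - p.1) = f (z - p.1) - p.2 (z - p.1) := rfl
  have hle := (le_abs_self _).trans (hfN (z - p.1))
  have hnorm : ‖z - p.1‖ ≤ (1 + ‖z‖) * (1 + ‖p.1‖) := by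
    nlinarith [norm_sub_le z p.1, mul_nonneg (norm_nonneg z) (norm_nonneg p.1)]
  have := mul_le_mul_of_nonneg_left hnorm hN
  linarith

/-- On a barrelled space, a monotone operator whose domain has an algebraic interior point `a`
satisfies a global norm estimate which is affine in the functional. -/
theorem IsMonotone.exists_abs_apply_le [BarrelledSpace ℝ X] (hT : IsMonotone T) {a : X}
    (ha : a ∈ core (domain T)) :
    ∃ K C : ℝ, 0 ≤ K ∧ 0 ≤ C ∧ ∀ p ∈ graph T, 0 ≤ K * (1 + ‖p.1‖) + p.2 (p.1 - a) ∧
      ∀ v, |p.2 v| ≤ C * ‖v‖ * (K * (1 + ‖p.1‖) + p.2 (p.1 - a)) := by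
  have haD : a ∈ domain T := by
    obtain ⟨δ, hδ, h⟩ := ha 0
    simpa using h 0 ⟨le_rfl, hδ.le⟩
  obtain ⟨K, hK, hKle⟩ := hT.exists_apply_sub_le haD
  -- `K + 1` instead of `K` keeps `D p ≥ 1 + ‖p.1‖`, so one can divide by `D p`.
  set D : X × WeakDual ℝ X → ℝ := fun p => (K + 1) * (1 + ‖p.1‖) + p.2 (p.1 - a) with hD
  have hDge : ∀ p ∈ graph T, 1 + ‖p.1‖ ≤ D p := by
    intro p hp
    have h := hKle p hp
    rw [← neg_sub p.1 a, map_neg] at h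
    simp only [hD]
    linarith
  have hDpos : ∀ p ∈ graph T, 0 < D p := fun p hp =>
    lt_of_lt_of_le (by positivity) (hDge p hp)
  -- Monotonicity against a value of `T` at `a + δ • v` bounds `p.2 v` from above; `-v` will give
  -- the other side.
  have hupper : ∀ v : X, ∃ M : ℝ, ∀ p ∈ graph T, p.2 v ≤ M * D p := by
    intro v
    obtain ⟨δ, hδ, h⟩ := ha v
    obtain ⟨L, hL, hLle⟩ := hT.exists_apply_sub_le (h δ ⟨hδ.le, le_rfl⟩)
    refine ⟨(L + 1) / δ, fun p hp => ?_⟩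
    have h1 := hLle p hp
    have h2 : p.2 (a + δ • v - p.1) = δ * p.2 v - p.2 (p.1 - a) := by
      rw [show a + δ • v - p.1 = δ • v - (p.1 - a) by abel, map_sub, map_smul, smul_eq_mul]
    have h3 := mul_le_mul_of_nonneg_left (hDge p hp) hL
    have h4 : p.2 (p.1 - a) ≤ D p := by
      simp only [hD]
      have : 0 ≤ (K + 1) * (1 + ‖p.1‖) := by positivity
      linarith
    rw [div_mul_eq_mul_div, le_div_iff₀ hδ]
    linarith
  let F : graph T → X →L[ℝ] ℝ := fun p => (D p)⁻¹ • WeakDual.toStrongDual (p : X × WeakDual ℝ X).2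
  have hF : ∀ (p : graph T) (v : X), F p v = (D p)⁻¹ * (p : X × WeakDual ℝ X).2 v :=
    fun _ _ => rfl
  have hequi : UniformEquicontinuous ((↑) ∘ F) := by
    refine (norm_withSeminorms ℝ ℝ).banach_steinhaus fun _ v => ?_
    obtain ⟨M, hM⟩ := hupper v
    obtain ⟨M', hM'⟩ := hupper (-v)
    refine ⟨max M M', ?_⟩
    rintro _ ⟨p, rfl⟩
    have hp := hDpos p p.2
    have h1 := hM p p.2
    have h2 := hM' p p.2
    rw [map_neg] at h2
    change |F p v| ≤ _
    rw [hF, abs_mul, abs_of_pos (inv_pos.2 hp), inv_mul_le_iff₀ hp, abs_le]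
    have h3 := mul_le_mul_of_nonneg_right (le_max_left M M') hp.le
    have h4 := mul_le_mul_of_nonneg_right (le_max_right M M') hp.le
    constructor <;> linarith
  obtain ⟨C, hC, hCle⟩ := ((NormedSpace.equicontinuous_TFAE F).out 2 4).1 hequi
  refine ⟨K + 1, C, by positivity, hC, fun p hp => ⟨(hDpos p hp).le, fun v => ?_⟩⟩
  have h := hCle ⟨p, hp⟩ v
  rw [hF, Real.norm_eq_abs, abs_mul, abs_of_pos (inv_pos.2 (hDpos p hp)),
    inv_mul_le_iff₀ (hDpos p hp)] at h
  linarith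

/-- A pair which is monotonically related to the graph of a maximal monotone operator belongs to
that graph. -/
theorem IsMaximalMonotone.mem_of_forall (hT : IsMaximalMonotone T) {x : X} {f : WeakDual ℝ X}
    (h : ∀ p ∈ graph T, 0 ≤ (f - p.2) (x - p.1)) : f ∈ T x := by
  let S : X → Set (WeakDual ℝ X) := fun z => {g | g ∈ T z ∨ (z = x ∧ g = f)}
  have hS : IsMonotone S := by
    rintro ⟨z, g⟩ hzg ⟨z', g'⟩ hzg'
    rcases hzg with hzg | ⟨rfl, rfl⟩ <;> rcases hzg' with hzg' | ⟨rfl, rfl⟩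
    · exact hT.1 (z, g) hzg (z', g') hzg'
    · have := h (z, g) hzg
      have e : (g - g') (z - z') = (g' - g) (z' - z) := by
        rw [← neg_sub z' z, map_neg, ← neg_sub g' g]
        exact neg_neg ((g' - g) (z' - z))
      exact this.trans_eq e.symm
    · exact h (z', g') hzg'
    · simp
  have hSx : (x, f) ∈ graph S := Or.inr ⟨rfl, rfl⟩
  rw [hT.2 S hS fun p hp => Or.inl hp] at hSx
  exact hSx

/-- A lower bound for the evaluation at `v` on a set of functionals persists on its weak-star closed
convex hull. -/
theorem le_apply_of_mem_closure_convexHull {s : Set (WeakDual ℝ X)} {v : X} {c : ℝ}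
    (h : ∀ f ∈ s, c ≤ f v) : ∀ f ∈ closure (convexHull ℝ s), c ≤ f v := by
  have hclosed : IsClosed {f : WeakDual ℝ X | c ≤ f v} :=
    isClosed_le continuous_const (WeakDual.eval_continuous v)
  have hconvex : Convex ℝ {f : WeakDual ℝ X | c ≤ f v} :=
    convex_halfSpace_ge (f := fun f : WeakDual ℝ X => f v) ⟨fun _ _ => rfl, fun _ _ => rfl⟩ c
  exact closure_minimal (convexHull_min h hconvex) hclosed

end MonotoneOperators

theorem theorem40 {X : Type u} [NormedAddCommGroup X] [NormedSpace ℝ X]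
    [BarrelledSpace ℝ X] (T : X → Set (WeakDual ℝ X))
    (hT : MonotoneOperators.IsMaximalMonotone T)
    (hcore : (MonotoneOperators.core (MonotoneOperators.domain T)).Nonempty) :
    MonotoneOperators.HasPropertyQ.{u, w} T := by
  intro x ι _ _ _ y hy f hf
  obtain ⟨a, ha⟩ := hcore
  obtain ⟨K, C, hK, hC, hbound⟩ := hT.1.exists_abs_apply_le ha
  refine hT.mem_of_forall ?_
  rintro ⟨u, g⟩ hug
  obtain ⟨N, hN, hgN⟩ := MonotoneOperators.exists_forall_abs_apply_le g
  have key : ∀ η : ℝ, 0 < η → η ≤ 1 → C * η ≤ 1 / 2 →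
      0 ≤ f (x - u) - g (x - u) + η * (2 * C * (K * (2 + ‖x‖) + f (x - a)) + N) := by
    intro η hη hη1 hCη
    obtain ⟨i, hi⟩ := eventually_atTop.1 (hy.eventually (Metric.closedBall_mem_nhds x hη))
    have hfi := Set.mem_iInter.1 hf i
    -- The error bound contains `η * (2 * C) * h (x - a)`; moving it to the side of `h` produces
    -- this test vector.
    have hle : ∀ h ∈ ⋃ j ∈ Set.Ici i, T (y j),
        g (x - u) - η * (2 * C * (K * (2 + ‖x‖)) + N) ≤ h ((x - u) + (η * (2 * C)) • (x - a)) := by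
      intro h hh
      simp only [Set.mem_iUnion] at hh
      obtain ⟨j, hij, hj⟩ := hh
      have hxy : ‖x - y j‖ ≤ η := by
        rw [← dist_eq_norm, dist_comm]
        exact hi j hij
      have hyn : ‖y j‖ ≤ 1 + ‖x‖ := by
        have : ‖y j‖ ≤ ‖x‖ + ‖x - y j‖ := by
          simpa using norm_sub_le x (x - y j)
        linarith
      obtain ⟨hD, hh⟩ := hbound (y j, h) hj
      simp only at hD hh
      set D := K * (1 + ‖y j‖) + h (y j - a) with hDdef
      have h1 : |h (x - y j)| ≤ C * η * D :=
        (hh _).trans (by gcongr)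
      have h2 : h (y j - a) = h (x - a) - h (x - y j) := by
        rw [← map_sub]; congr 1; abel
      -- Passing from `y j` to `x` inside `D` costs at most `C * η * D ≤ D / 2`, which is absorbed
      -- on the left.
      have h3 : D ≤ 2 * (K * (2 + ‖x‖) + h (x - a)) := by
        have h4 : K * (1 + ‖y j‖) ≤ K * (2 + ‖x‖) :=
          mul_le_mul_of_nonneg_left (by linarith) hK
        have h5 := mul_le_mul_of_nonneg_right hCη hD
        have := neg_abs_le (h (x - y j))
        linarith
      have h6 : C * η * D ≤ C * η * (2 * (K * (2 + ‖x‖) + h (x - a))) := by gcongr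
      have h7 : |g (x - y j)| ≤ N * η := (hgN _).trans (by gcongr)
      have hmon : 0 ≤ h (y j - u) - g (y j - u) := hT.1 (y j, h) hj (u, g) hug
      have h8 : ∀ k : WeakDual ℝ X, k (y j - u) = k (x - u) - k (x - y j) := by
        intro k
        rw [← map_sub]; congr 1; abel
      rw [h8 h, h8 g] at hmon
      rw [map_add, map_smul, smul_eq_mul]
      have := neg_abs_le (h (x - y j))
      have := le_abs_self (g (x - y j))
      linarith
    have := MonotoneOperators.le_apply_of_mem_closure_convexHull hle f hfi
    rw [map_add, map_smul, smul_eq_mul] at this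
    linarith
  have hlim : Tendsto (fun η : ℝ =>
      f (x - u) - g (x - u) + η * (2 * C * (K * (2 + ‖x‖) + f (x - a)) + N)) (𝓝[>] 0)
      (𝓝 (f (x - u) - g (x - u))) := by
    refine Tendsto.mono_left (Continuous.tendsto' (by fun_prop) _ _ (by simp)) nhdsWithin_le_nhds
  have hsmall : ∀ᶠ η : ℝ in 𝓝[>] 0, C * η ≤ 1 / 2 := by
    refine Filter.Eventually.filter_mono nhdsWithin_le_nhds ?_
    have : Tendsto (fun η : ℝ => C * η) (𝓝 0) (𝓝 0) :=
      Continuous.tendsto' (by fun_prop) _ _ (by simp)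
    exact this.eventually (Iic_mem_nhds (by norm_num))
  refine ge_of_tendsto hlim ?_
  filter_upwards [Ioc_mem_nhdsGT (zero_lt_one (α := ℝ)), hsmall] with η hη hη'
  exact key η hη.1 hη.2 hη'
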